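/- Let $M$ be a smooth $n$-dimensional manifold, let $0<T\le\infty$, and let $g_t$, $t\in[0,T)$, be Riemannian metrics on $M$ depending smoothly on $(x,t)\in M\times[0,T)$. Assume that for each $t\in[0,T)$ the metric $g=g_t$ satisfies the (Hessian form of the) Omori–Yau maximum principle at infinity: for every $f\in C^2(M)$ that is bounded above there is a sequence $(x_k)_{k\ge1}$ in $M$ with $$f(x_k)>\sup_M f-\tfrac1k,\qquad |\nabla f|_{g}(x_k)<\tfrac1k,\qquad \nabla\nabla f(x_k)<\tfrac1k\,g .$$ Let $u:M\times[0,T)\to\mathbb R$ be smooth, let $C:(0,T)\to\mathbb R$ be a function and $\alpha\in(0,1]$, and assume that for every $t\in(0,T)$ and all $x\in M$, $s,s'\in(0,t]$, $$|u(x,t)|\le C(t),\quad |\nabla^{g_t}u(x,t)|_{g_t}\le C(t),\quad |u_t(x,s)|\le C(t),\quad |u_t(x,s)-u_t(x,s')|\le C(t)\,|s-s'|^\alpha .$$ Assume that on $M\times(0,T)$ $$\left(\partial_t-H^{ij}\nabla^{g_t}_i\nabla^{g_t}_j\right)u=\left\langle X(x,u,\nabla^{g_t}u,t),\nabla^{g_t}u\right\rangle_{g_t}+F(u),$$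 where $F:\mathbb R\to\mathbb R$ is locally Lipschitz; $H_{ij}(x,t)$ is a symmetric positive definite $2$-tensor on $T_xM$ (indices raised with $g_t$) with $|H|_{g_t}\le C_0$ for a constant $C_0$; and $X(x,r,v,t)\in T_xM$ (for $r\in\mathbb R$, $v\in T_xM$) satisfies $|X(x,u,\nabla^{g_t}u,t)|_{g_t}\le C_1(t)$ for all $x\in M$, $t\in(0,T)$, with some function $C_1$ of $t$. Put $u_{\sup}(t)=\sup_{x\in M}u(x,t)$. Then: 1. $u_{\sup}(t)$ is finite for each $t\in[0,T)$, and $u_{\sup}$ is locally Lipschitz on $[0,T)$ and hence differentiable at almost every $t\in[0,T)$. 2. At every $t\in(0,T)$ at which $u_{\sup}$ is differentiable, $$\frac{d u_{\sup}}{dt}(t)=\lim_{k\to\infty}\frac{\partial u}{\partial t}(x_k,t)$$ for every sequence $(x_k)$ in $M$ with $\lim_{k\to\infty}u(x_k,t)=u_{\sup}(t)$. 3. If $0<T'\le\infty$ and $\varphi:[0,T')\to\mathbb R$ solves $\varphi'(t)=F(\varphi(t))$ on $[0,T')$, $\varphi(0)=u_{\sup}(0)$ (in particular if $\varphi$ is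 the maximal solution), then $u(x,t)\le\varphi(t)$ for all $(x,t)\in M\times[0,\min\{T,T'\})$. -/

import Mathlib

open Set Filter Topology MeasureTheory Bundle
open scoped Manifold ContDiff

noncomputable section

/-- Smooth Riemannian metrics on the `n`-dimensional manifold `M`. -/
abbrev SmoothMetric (n : ℕ) (M : Type*) [TopologicalSpace M]
    [ChartedSpace (EuclideanSpace ℝ (Fin n)) M] [IsManifold (𝓡 n) ∞ M] :=
  ContMDiffRiemannianMetric (𝓡 n) ∞ (EuclideanSpace ℝ (Fin n))
    (fun x : M => TangentSpace (𝓡 n) x)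

/-- The half-open time interval `[0, T)`, where `T = ∞` is allowed. -/
def timeIco (T : EReal) : Set ℝ := {t | 0 ≤ t ∧ (t : EReal) < T}

/-- The open time interval `(0, T)`, where `T = ∞` is allowed. -/
def timeIoo (T : EReal) : Set ℝ := {t | 0 < t ∧ (t : EReal) < T}

namespace RiemCoord

variable {n : ℕ} {M : Type*} [TopologicalSpace M]
  [ChartedSpace (EuclideanSpace ℝ (Fin n)) M]

/-- The standard basis vector `e_i` of `ℝⁿ`. -/
def stdVec (i : Fin n) : EuclideanSpace ℝ (Fin n) := EuclideanSpace.single i (1 : ℝ)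

/-- The coordinate vector field `∂_i` of the chart around `x`, at the point of `M` with
coordinates `y`. -/
def coordField (x : M) (i : Fin n) (y : EuclideanSpace ℝ (Fin n)) :
    TangentSpace (𝓡 n) ((extChartAt (𝓡 n) x).symm y) :=
  mfderiv 𝓘(ℝ, EuclideanSpace ℝ (Fin n)) (𝓡 n) (extChartAt (𝓡 n) x).symm y (stdVec i)

/-- The coordinate tangent vector `∂_i` at `x` of the chart around `x`. -/
def frame (x : M) (i : Fin n) : TangentSpace (𝓡 n) x :=
  mfderiv 𝓘(ℝ, EuclideanSpace ℝ (Fin n)) (𝓡 n) (extChartAt (𝓡 n) x).symm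
    (extChartAt (𝓡 n) x x) (stdVec i)

/-- The components `A_{ij} = A(∂_i, ∂_j)` at `x` of a bilinear form on `T_x M`. -/
def comp (x : M)
    (A : TangentSpace (𝓡 n) x →L[ℝ] TangentSpace (𝓡 n) x →L[ℝ] ℝ) :
    Matrix (Fin n) (Fin n) ℝ :=
  Matrix.of fun i j => A (frame x i) (frame x j)

/-- The coordinate expression of a function `f` in the chart around `x`. -/
def coordFun (f : M → ℝ) (x : M) (y : EuclideanSpace ℝ (Fin n)) : ℝ :=
  f ((extChartAt (𝓡 n) x).symm y)

/-- The first partial derivative `∂_i f` in the chart around `x`, at the coordinates `y`. -/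
def partialD (f : M → ℝ) (x : M) (i : Fin n) (y : EuclideanSpace ℝ (Fin n)) : ℝ :=
  fderiv ℝ (coordFun f x) y (stdVec i)

/-- The second partial derivative `∂_i ∂_j f` at `x` in the chart around `x`. -/
def partialD2 (f : M → ℝ) (x : M) (i j : Fin n) : ℝ :=
  fderiv ℝ (partialD f x j) (extChartAt (𝓡 n) x x) (stdVec i)

variable [IsManifold (𝓡 n) ∞ M]

/-- The metric coefficients `g_{ij}` in the chart around `x`, at the coordinates `y`. -/
def metricCoeff (g : SmoothMetric n M) (x : M) (i j : Fin n)
    (y : EuclideanSpace ℝ (Fin n)) : ℝ :=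
  g.inner ((extChartAt (𝓡 n) x).symm y) (coordField x i y) (coordField x j y)

/-- The matrix `(g_{ij})` at `x`. -/
def metricMat (g : SmoothMetric n M) (x : M) : Matrix (Fin n) (Fin n) ℝ :=
  comp x (g.inner x)

/-- The inverse matrix `(g^{ij})` at `x`. -/
def invMetric (g : SmoothMetric n M) (x : M) : Matrix (Fin n) (Fin n) ℝ :=
  (metricMat g x)⁻¹

/-- The derivative `∂_k g_{ij}` at `x`. -/
def dMetric (g : SmoothMetric n M) (x : M) (k i j : Fin n) : ℝ :=
  fderiv ℝ (metricCoeff g x i j) (extChartAt (𝓡 n) x x) (stdVec k)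

/-- The Christoffel symbols `Γ^k_{ij}` of the Levi-Civita connection at `x`. -/
def christoffel (g : SmoothMetric n M) (x : M) (k i j : Fin n) : ℝ :=
  (1 / 2) * ∑ l, invMetric g x k l * (dMetric g x i j l + dMetric g x j i l - dMetric g x l i j)

/-- The components `∇_i ∇_j f = ∂_i ∂_j f - Γ^k_{ij} ∂_k f` at `x` of the Hessian of `f`. -/
def hess (g : SmoothMetric n M) (f : M → ℝ) (x : M) : Matrix (Fin n) (Fin n) ℝ :=
  Matrix.of fun i j => partialD2 f x i j
    - ∑ k, christoffel g x k i j * partialD f x k (extChartAt (𝓡 n) x x)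

/-- The gradient `∇f = g^{ij} ∂_j f ∂_i` at `x`. -/
def grad (g : SmoothMetric n M) (f : M → ℝ) (x : M) : TangentSpace (𝓡 n) x :=
  ∑ i, (∑ j, invMetric g x i j * partialD f x j (extChartAt (𝓡 n) x x)) • frame x i

/-- The length `|v|_g` of a tangent vector. -/
def vecNorm (g : SmoothMetric n M) (x : M) (v : TangentSpace (𝓡 n) x) : ℝ :=
  Real.sqrt (g.inner x v v)

/-- The contraction `A^{ij} B_{ij} = g^{ik} g^{jl} A_{kl} B_{ij}` at `x`, for the components
`A_{ij}`, `B_{ij}` of two covariant 2-tensors. -/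
def contract (g : SmoothMetric n M) (x : M) (A B : Matrix (Fin n) (Fin n) ℝ) : ℝ :=
  ∑ i, ∑ j, ∑ k, ∑ l, invMetric g x i k * invMetric g x j l * A k l * B i j

/-- The norm `|A|_g = (A^{ij} A_{ij})^{1/2}` at `x` of a covariant 2-tensor. -/
def tensorNorm (g : SmoothMetric n M) (x : M) (A : Matrix (Fin n) (Fin n) ℝ) : ℝ :=
  Real.sqrt (contract g x A A)

/-- The Omori-Yau maximum principle at infinity (in its Hessian form) holds for `(M, g)`: for every
`C²` function `f` bounded above there is a sequence of points `x_k` with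
`f(x_k) > sup f - 1/k`, `|∇f|(x_k) < 1/k` and `∇∇f(x_k) < (1/k) g` as quadratic forms
(`k ≥ 1` is written `k + 1` with `k : ℕ`). -/
def OmoriYau (g : SmoothMetric n M) : Prop :=
  ∀ f : M → ℝ, ContMDiff (𝓡 n) 𝓘(ℝ, ℝ) 2 f → BddAbove (range f) →
    ∃ x : ℕ → M, ∀ k : ℕ,
      f (x k) > (⨆ y, f y) - 1 / ((k : ℝ) + 1) ∧
      vecNorm g (x k) (grad g f (x k)) < 1 / ((k : ℝ) + 1) ∧
      ∀ v : Fin n → ℝ, v ≠ 0 →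
        ∑ i, ∑ j, hess g f (x k) i j * v i * v j
          < 1 / ((k : ℝ) + 1) * ∑ i, ∑ j, metricMat g (x k) i j * v i * v j

/-- The family of metrics `g t` depends smoothly on `(x, t)` for `t ∈ [0, T)`. -/
def SmoothFamily (T : EReal) (g : ℝ → SmoothMetric n M) : Prop :=
  ContMDiffOn ((𝓡 n).prod 𝓘(ℝ, ℝ))
    ((𝓡 n).prod 𝓘(ℝ, EuclideanSpace ℝ (Fin n) →L[ℝ] EuclideanSpace ℝ (Fin n) →L[ℝ] ℝ)) ∞
    (fun p : M × ℝ => TotalSpace.mk'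
      (EuclideanSpace ℝ (Fin n) →L[ℝ] EuclideanSpace ℝ (Fin n) →L[ℝ] ℝ)
      (E := fun x : M => TangentSpace (𝓡 n) x →L[ℝ] TangentSpace (𝓡 n) x →L[ℝ] ℝ)
      p.1 ((g p.2).inner p.1))
    (univ ×ˢ timeIco T)

/-- The spatial supremum `u_sup(t) = sup_x u(x, t)`. -/
def supSpace (u : M → ℝ → ℝ) (t : ℝ) : ℝ := ⨆ x, u x t

end RiemCoord

end

/-!
For `t > 0` the Hölder bound on `u_t` makes the first-order expansions of the functions `u(x, ·)`
at `t` uniform in `x`. Comparing `u(x_k, ·) ≤ u_sup` along a maximizing sequence `x_k` shows that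
`u_t(x_k, t)` tends to `u_sup'(t)` wherever the latter exists, and that in any case the left slopes
of `u_sup` at `t` are eventually below every number exceeding `limsup u_t(x_k, t)`. The Omori–Yau
sequence of `u(·, t)` is maximizing, and along it the elliptic term and the drift term contribute at
most `(√n C₀ + C₁(t)) / k`, so the left Dini derivative of `u_sup` is at most `F(u_sup)` at *every*
`t > 0`. A Grönwall argument run backwards in time then yields `u_sup ≤ φ`.
-/

section Calculus

theorem lipschitzOnWith_Icc_of_abs_deriv_le {f : ℝ → ℝ} {a b K : ℝ} (hab : a < b)
    (hf : ContinuousOn f (Icc a b)) (hd : ∀ t ∈ Ioo a b, DifferentiableAt ℝ f t)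
    (hK : ∀ t ∈ Ioo a b, |deriv f t| ≤ K) : LipschitzOnWith K.toNNReal f (Icc a b) := by
  have hIoo : LipschitzOnWith K.toNNReal f (Ioo a b) :=
    (convex_Ioo a b).lipschitzOnWith_of_nnnorm_deriv_le hd fun t ht =>
      NNReal.coe_le_coe.mp <| (hK t ht).trans (Real.le_coe_toNNReal K)
  rw [← closure_Ioo hab.ne] at hf ⊢
  exact hIoo.closure hf

theorem lipschitzOnWith_iSup {ι X : Type*} [Nonempty ι] [PseudoMetricSpace X] {f : ι → X → ℝ}
    {s : Set X} {K : NNReal} (hf : ∀ i, LipschitzOnWith K (f i) s)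
    (hbdd : ∀ x ∈ s, BddAbove (range fun i => f i x)) :
    LipschitzOnWith K (fun x => ⨆ i, f i x) s :=
  .of_le_add_mul K fun _ hx y hy => ciSup_le fun i =>
    ((hf i).le_add_mul hx hy).trans (add_le_add_left (le_ciSup (hbdd y hy) i) _)

theorem bddAbove_range_of_lipschitzOnWith {ι X : Type*} [PseudoMetricSpace X] {f : ι → X → ℝ}
    {s : Set X} {K : NNReal} (hf : ∀ i, LipschitzOnWith K (f i) s) {x y : X} (hx : x ∈ s)
    (hy : y ∈ s) (hbdd : BddAbove (range fun i => f i y)) :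
    BddAbove (range fun i => f i x) := by
  obtain ⟨c, hc⟩ := hbdd
  exact ⟨c + K * dist x y, forall_mem_range.mpr fun i =>
    ((hf i).le_add_mul hx hy).trans (add_le_add_left (hc (mem_range_self i)) _)⟩

theorem equicontinuousAt_of_dist_le_rpow {ι X Y : Type*} [PseudoMetricSpace X]
    [PseudoMetricSpace Y] {f : ι → X → Y} {x : X} {C α : ℝ} (hα : 0 < α)
    (hf : ∀ᶠ y in 𝓝 x, ∀ i, dist (f i x) (f i y) ≤ C * dist x y ^ α) :
    EquicontinuousAt f x := by
  refine Metric.equicontinuousAt_of_continuity_modulus (fun y => C * dist x y ^ α) ?_ f hf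
  have hcont : Continuous fun y => C * dist x y ^ α :=
    continuous_const.mul ((continuous_const.dist continuous_id).rpow_const fun _ => .inr hα.le)
  simpa [hα.ne'] using hcont.tendsto x

theorem ae_differentiableAt_of_locallyLipschitzOn {f : ℝ → ℝ} {s : Set ℝ} (hs : OrdConnected s)
    (hf : LocallyLipschitzOn s f) : ∀ᵐ t ∂(volume.restrict s), DifferentiableAt ℝ f t := by
  have hbv : LocallyBoundedVariationOn f s := fun a b ha hb => by
    obtain ⟨K, hK⟩ := (hf.mono (hs.out ha hb)).exists_lipschitzOnWith_of_compact isCompact_Icc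
    rcases le_or_gt a b with hab | hab
    · exact ne_top_of_le_ne_top
        (hK.locallyBoundedVariationOn a b (left_mem_Icc.mpr hab) (right_mem_Icc.mpr hab))
        (eVariationOn.mono f fun t ht => ⟨ht.2, ht.2⟩)
    · simp [BoundedVariationOn, Icc_eq_empty hab.not_ge]
  have hfrontier : ∀ᵐ t ∂(volume.restrict s), t ∉ frontier s :=
    ae_restrict_of_ae (measure_eq_zero_iff_ae_notMem.mp (hs.convex.addHaar_frontier volume))
  filter_upwards [hbv.ae_differentiableWithinAt hs.measurableSet, hfrontier,
    ae_restrict_mem hs.measurableSet] with t ht htf hts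
  refine ht.differentiableAt (mem_interior_iff_mem_nhds.mp ?_)
  by_contra hint
  exact htf ⟨subset_closure hts, hint⟩

end Calculus

section LeftDini

theorem le_image_of_liminf_slope_left_lt_deriv_boundary {f f' B B' : ℝ → ℝ} {a b : ℝ}
    (hf : ContinuousOn f (Icc a b))
    (hf' : ∀ x ∈ Ioc a b, ∀ r, f' x < r → ∃ᶠ z in 𝓝[<] x, slope f x z < r)
    (hb : B b ≤ f b) (hB : ContinuousOn B (Icc a b))
    (hB' : ∀ x ∈ Ioc a b, HasDerivWithinAt B (B' x) (Iic x) x)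
    (bound : ∀ x ∈ Ioc a b, f x = B x → f' x < B' x) {x : ℝ} (hx : x ∈ Icc a b) :
    B x ≤ f x := by
  have hslope : ∀ y z, slope (fun τ => -f (-τ)) y z = slope f (-y) (-z) := fun y z => by
    rw [slope_def_field, slope_def_field, ← neg_div_neg_eq]
    ring
  have hIcc : MapsTo Neg.neg (Icc (-b) (-a)) (Icc a b) := fun τ hτ =>
    ⟨le_neg.mpr hτ.2, neg_le.mpr hτ.1⟩
  have hIco : ∀ τ ∈ Ico (-b) (-a), -τ ∈ Ioc a b := fun τ hτ =>
    ⟨lt_neg.mpr hτ.2, neg_le.mpr hτ.1⟩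
  have key := image_le_of_liminf_slope_right_lt_deriv_boundary'
    (f := fun τ => -f (-τ)) (f' := fun τ => f' (-τ))
    (B := fun τ => -B (-τ)) (B' := fun τ => B' (-τ)) (a := -b) (b := -a)
    (hf.comp continuousOn_neg hIcc).neg ?_ (by simpa using hb)
    (hB.comp continuousOn_neg hIcc).neg ?_
    (fun τ hτ h => bound _ (hIco τ hτ) (neg_inj.mp h)) ⟨neg_le_neg hx.2, neg_le_neg hx.1⟩
  · simpa using key
  · intro τ hτ r hr
    have hfreq := (tendsto_neg_nhdsLT (a := -τ)).frequently
      (p := fun z => slope (fun τ => -f (-τ)) τ z < r)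
      (by simpa only [hslope, neg_neg] using hf' (-τ) (hIco τ hτ) r hr)
    rwa [neg_neg] at hfreq
  · intro τ hτ
    have hmaps : MapsTo Neg.neg (Ici τ) (Iic (-τ)) := fun _ h => neg_le_neg (mem_Ici.mp h)
    exact ((hB' (-τ) (hIco τ hτ)).comp τ (hasDerivAt_neg τ).hasDerivWithinAt hmaps).fun_neg
      |>.congr_deriv (by ring)

theorem nonpos_of_liminf_slope_left_le {w : ℝ → ℝ} {a b L : ℝ} (hab : a ≤ b)
    (hw : ContinuousOn w (Icc a b))
    (hw' : ∀ t ∈ Ioc a b, ∀ r, L * |w t| < r → ∃ᶠ s in 𝓝[<] t, slope w t s < r)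
    (ha : w a ≤ 0) : w b ≤ 0 := by
  by_contra! hb
  -- Followed backwards in time from `b`, the positive barrier `B` stays below `w`.
  set B : ℝ → ℝ := fun t => w b * Real.exp ((L + 1) * (t - b))
  have hBpos : ∀ t, 0 < B t := fun t => mul_pos hb (Real.exp_pos _)
  have hBderiv : ∀ t, HasDerivAt B ((L + 1) * B t) t := fun t =>
    (((((hasDerivAt_id t).sub_const b).const_mul (L + 1)).exp).const_mul (w b)).congr_deriv (by
      simp only [id_eq, mul_one, B]; ring)
  have hBw : B a ≤ w a := le_image_of_liminf_slope_left_lt_deriv_boundary hw hw' (by simp [B])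
    (fun t _ => (hBderiv t).continuousAt.continuousWithinAt)
    (fun t _ => (hBderiv t).hasDerivWithinAt)
    (fun t _ h => by rw [h, abs_of_pos (hBpos t)]; linarith [hBpos t])
    (left_mem_Icc.mpr hab)
  linarith [hBpos a]

theorem le_of_liminf_slope_left_le {S φ F : ℝ → ℝ} {a b : ℝ} (hab : a ≤ b)
    (hF : LocallyLipschitz F) (hS : ContinuousOn S (Icc a b))
    (hS' : ∀ t ∈ Ioc a b, ∀ r, F (S t) < r → ∃ᶠ s in 𝓝[<] t, slope S t s < r)
    (hφ : ContinuousOn φ (Icc a b))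
    (hφ' : ∀ t ∈ Ioc a b, HasDerivWithinAt φ (F (φ t)) (Iio t) t)
    (ha : S a ≤ φ a) : S b ≤ φ b := by
  obtain ⟨L, hL⟩ := hF.locallyLipschitzOn (s := S '' Icc a b ∪ φ '' Icc a b)
    |>.exists_lipschitzOnWith_of_compact
      ((isCompact_Icc.image_of_continuousOn hS).union (isCompact_Icc.image_of_continuousOn hφ))
  rw [← sub_nonpos] at ha ⊢
  refine nonpos_of_liminf_slope_left_le (w := fun t => S t - φ t) (L := L) hab (hS.sub hφ)
    (fun t ht r hr => ?_) ha
  have hFL : F (S t) - F (φ t) ≤ L * |S t - φ t| :=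
    (le_abs_self _).trans <| hL.dist_le_mul _ (.inl (mem_image_of_mem S (Ioc_subset_Icc_self ht)))
      _ (.inr (mem_image_of_mem φ (Ioc_subset_Icc_self ht)))
  obtain ⟨q, hFq, hqr⟩ := exists_between (show F (S t) < r + F (φ t) by linarith)
  have hφslope : ∀ᶠ s in 𝓝[<] t, q - r < slope φ t s := by
    have hlim := hasDerivWithinAt_iff_tendsto_slope' (by simp) |>.mp (hφ' t ht)
    exact hlim.eventually_const_lt (by linarith)
  refine ((hS' t ht q hFq).and_eventually hφslope).mono fun s hs => ?_
  have hsub : slope (fun t => S t - φ t) t s = slope S t s - slope φ t s := by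
    simp only [slope_def_field]
    ring
  linarith [hs.1, hs.2]

end LeftDini

/-- Differentiability at `t` uniformly in the index: the first-order expansions at `t` of the
functions `u i` have a common error `o(s - t)`. Each `u i` is then differentiable at `t`, so that
`deriv` takes no junk value here. -/
def EquidifferentiableAt {ι : Type*} (u : ι → ℝ → ℝ) (t : ℝ) : Prop :=
  ∀ ε > 0, ∀ᶠ s in 𝓝 t, ∀ i, |u i s - u i t - (s - t) * deriv (u i) t| ≤ ε * |s - t|

namespace EquidifferentiableAt

variable {ι κ : Type*} {u : ι → ℝ → ℝ} {t : ℝ} {l : Filter κ} {x : κ → ι}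

theorem differentiableAt (hu : EquidifferentiableAt u t) (i : ι) :
    DifferentiableAt ℝ (u i) t :=
  (hasDerivAt_iff_isLittleO.mpr <| Asymptotics.isLittleO_iff.mpr fun _ hε =>
    (hu _ hε).mono fun _ hs => hs i).differentiableAt

theorem of_equicontinuousAt_deriv (hd : ∀ᶠ s in 𝓝 t, ∀ i, DifferentiableAt ℝ (u i) s)
    (hu : EquicontinuousAt (fun i => deriv (u i)) t) : EquidifferentiableAt u t := by
  intro ε hε
  obtain ⟨δ, hδ, hball⟩ := Metric.eventually_nhds_iff_ball.mp
    (hd.and (Metric.equicontinuousAt_iff_right.mp hu ε hε))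
  filter_upwards [Metric.ball_mem_nhds t hδ] with s hs i
  have hderiv : ∀ r ∈ Metric.ball t δ, HasDerivWithinAt (fun r => u i r - r * deriv (u i) t)
      (deriv (u i) r - deriv (u i) t) (Metric.ball t δ) r := fun r hr =>
    ((((hball r hr).1 i).hasDerivAt.sub ((hasDerivAt_id r).mul_const _)).congr_deriv
      (by simp)).hasDerivWithinAt
  have hmean := (convex_ball t δ).norm_image_sub_le_of_norm_hasDerivWithin_le hderiv
    (fun r hr => by simpa [Real.dist_eq, abs_sub_comm] using ((hball r hr).2 i).le)
    (Metric.mem_ball_self hδ) hs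
  calc |u i s - u i t - (s - t) * deriv (u i) t|
      = |u i s - s * deriv (u i) t - (u i t - t * deriv (u i) t)| := by ring_nf
    _ ≤ ε * |s - t| := hmean

theorem tendsto_deriv_of_hasDerivAt_iSup (hu : EquidifferentiableAt u t)
    (hbdd : ∀ᶠ s in 𝓝 t, BddAbove (range fun i => u i s)) {D : ℝ}
    (hD : HasDerivAt (fun s => ⨆ i, u i s) D t)
    (hx : Tendsto (fun k => u (x k) t) l (𝓝 (⨆ i, u i t))) :
    Tendsto (fun k => deriv (u (x k)) t) l (𝓝 D) := by
  set S : ℝ → ℝ := fun s => ⨆ i, u i s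
  refine Metric.tendsto_nhds.mpr fun ε hε => ?_
  have hε4 : 0 < ε / 4 := by positivity
  -- `u i ≤ S` with near equality at `t` squeezes the slope of `u i` from both sides of `t`.
  have hexp : ∀ᶠ s in 𝓝 t, ∀ i, S t - ε / 4 * |s - t| < u i t →
      (s - t) * (deriv (u i) t - D) ≤ 3 * (ε / 4) * |s - t| := by
    filter_upwards [hu _ hε4, hbdd, (hasDerivAt_iff_isLittleO.mp hD).def hε4]
      with s hus hbs hSs i hi
    have hle : u i s ≤ S s := le_ciSup hbs i
    rw [Real.norm_eq_abs, Real.norm_eq_abs, smul_eq_mul] at hSs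
    linarith [neg_le_of_abs_le (hus i), le_of_abs_le hSs]
  obtain ⟨δ, hδ, hball⟩ := Metric.eventually_nhds_iff_ball.mp hexp
  set h := δ / 2
  have hh : 0 < h := by positivity
  have hhδ : h < δ := half_lt_self hδ
  have hright := hball (t + h) (by simpa [abs_of_pos hh] using hhδ)
  have hleft := hball (t - h) (by simpa [abs_of_pos hh] using hhδ)
  simp only [add_sub_cancel_left, sub_sub_cancel_left, abs_neg, abs_of_pos hh] at hright hleft
  filter_upwards [hx.eventually_const_lt (show S t - ε / 4 * h < S t by linarith [mul_pos hε4 hh])]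
    with k hk
  have hupper := hright (x k) hk
  have hlower := hleft (x k) hk
  rw [Real.dist_eq, abs_lt]
  constructor <;> nlinarith

theorem eventually_slope_iSup_lt [l.NeBot] (hu : EquidifferentiableAt u t)
    (hbdd : ∀ᶠ s in 𝓝 t, BddAbove (range fun i => u i s))
    (hx : Tendsto (fun k => u (x k) t) l (𝓝 (⨆ i, u i t))) {D r : ℝ}
    (hD : ∀ᶠ k in l, deriv (u (x k)) t ≤ D) (hr : D < r) :
    ∀ᶠ s in 𝓝[<] t, slope (fun s => ⨆ i, u i s) t s < r := by
  obtain ⟨q, hDq, hqr⟩ := exists_between hr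
  filter_upwards [nhdsWithin_le_nhds (hu (q - D) (sub_pos.mpr hDq)), nhdsWithin_le_nhds hbdd,
    self_mem_nhdsWithin] with s hus hbs hst
  have hts : 0 < t - s := sub_pos.mpr hst
  have hinc : (⨆ i, u i t) ≤ (⨆ i, u i s) + (t - s) * q := by
    refine le_of_tendsto hx (hD.mono fun k hk => ?_)
    have hexp := neg_le_of_abs_le (hus (x k))
    rw [abs_sub_comm, abs_of_pos hts] at hexp
    have hmul := mul_le_mul_of_nonneg_left hk hts.le
    linarith [le_ciSup hbs (x k)]
  rw [slope_comm, slope_def_field, div_lt_iff₀ hts]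
  linarith [mul_lt_mul_of_pos_left hqr hts]

end EquidifferentiableAt

section TimeInterval

variable {T : EReal} {b : ℝ}

theorem exists_gt_mem_timeIoo {t : ℝ} (ht : t ∈ timeIco T) : ∃ b ∈ timeIoo T, t < b := by
  obtain ⟨b, htb, hb⟩ := EReal.lt_iff_exists_real_btwn.mp ht.2
  have htb : t < b := EReal.coe_lt_coe_iff.mp htb
  exact ⟨b, ⟨ht.1.trans_lt htb, hb⟩, htb⟩

theorem timeIoo_subset_timeIco : timeIoo T ⊆ timeIco T := fun _ ht => ⟨ht.1.le, ht.2⟩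

theorem timeIco_min (T T' : EReal) : timeIco (min T T') = timeIco T ∩ timeIco T' := by
  ext t
  simp only [timeIco, lt_min_iff, mem_inter_iff, mem_ofPred_eq]
  tauto

theorem Icc_subset_timeIco (hb : b ∈ timeIco T) : Icc 0 b ⊆ timeIco T :=
  fun _ ht => ⟨ht.1, (EReal.coe_le_coe_iff.mpr ht.2).trans_lt hb.2⟩

theorem Ioc_subset_timeIoo (hb : b ∈ timeIco T) : Ioc 0 b ⊆ timeIoo T :=
  fun _ ht => ⟨ht.1, (EReal.coe_le_coe_iff.mpr ht.2).trans_lt hb.2⟩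

theorem ordConnected_timeIco : OrdConnected (timeIco T) :=
  ⟨fun _ ha _ hb _ ht => Icc_subset_timeIco hb ⟨ha.1.trans ht.1, ht.2⟩⟩

theorem isOpen_timeIoo : IsOpen (timeIoo T) :=
  isOpen_Ioi.inter (isOpen_Iio.preimage continuous_coe_real_ereal)

theorem timeIco_mem_nhds {t : ℝ} (ht : t ∈ timeIoo T) : timeIco T ∈ 𝓝 t :=
  mem_of_superset (isOpen_timeIoo.mem_nhds ht) timeIoo_subset_timeIco

theorem locallyLipschitzOn_timeIco {f : ℝ → ℝ}
    (hf : ∀ b ∈ timeIoo T, ∃ K, LipschitzOnWith K f (Icc 0 b)) :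
    LocallyLipschitzOn (timeIco T) f := by
  intro t ht
  obtain ⟨b, hb, htb⟩ := exists_gt_mem_timeIoo ht
  obtain ⟨K, hK⟩ := hf b hb
  exact ⟨K, timeIco T ∩ Iio b, inter_mem_nhdsWithin _ (Iio_mem_nhds htb),
    hK.mono fun s hs => ⟨hs.1.1, hs.2.le⟩⟩

theorem lipschitzOnWith_Icc_of_mem_timeIoo {f : ℝ → ℝ} {K : ℝ} (hf : ContinuousOn f (timeIco T))
    (hd : ∀ t ∈ timeIoo T, DifferentiableAt ℝ f t) (hb : b ∈ timeIoo T)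
    (hK : ∀ t ∈ Ioc 0 b, |deriv f t| ≤ K) : LipschitzOnWith K.toNNReal f (Icc 0 b) :=
  have hb' := timeIoo_subset_timeIco hb
  lipschitzOnWith_Icc_of_abs_deriv_le hb.1 (hf.mono (Icc_subset_timeIco hb'))
    (fun t ht => hd t (Ioc_subset_timeIoo hb' (Ioo_subset_Ioc_self ht)))
    fun t ht => hK t (Ioo_subset_Ioc_self ht)

theorem le_of_liminf_slope_left_le_timeIco {T' : EReal} {S φ F : ℝ → ℝ} (hF : LocallyLipschitz F)
    (hS : ContinuousOn S (timeIco T))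
    (hS' : ∀ t ∈ timeIoo T, ∀ r, F (S t) < r → ∃ᶠ s in 𝓝[<] t, slope S t s < r)
    (hφ : ∀ t ∈ timeIco T', HasDerivWithinAt φ (F (φ t)) (timeIco T') t) (h0 : S 0 ≤ φ 0)
    {t : ℝ} (ht : t ∈ timeIco (min T T')) : S t ≤ φ t := by
  obtain ⟨htT, htT'⟩ := timeIco_min T T' ▸ ht
  have hφcont : ContinuousOn φ (timeIco T') := fun s hs => (hφ s hs).continuousWithinAt
  have hφderiv : ∀ s ∈ Ioc 0 t, HasDerivAt φ (F (φ s)) s := fun s hs =>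
    (hφ s (Icc_subset_timeIco htT' (Ioc_subset_Icc_self hs))).hasDerivAt
      (timeIco_mem_nhds (Ioc_subset_timeIoo htT' hs))
  exact le_of_liminf_slope_left_le ht.1 hF (hS.mono (Icc_subset_timeIco htT))
    (fun s hs => hS' s (Ioc_subset_timeIoo htT hs)) (hφcont.mono (Icc_subset_timeIco htT'))
    (fun s hs => (hφderiv s hs).hasDerivWithinAt) h0

variable {ι : Type*} {u : ι → ℝ → ℝ} {K : ℝ → NNReal}

theorem bddAbove_range_of_mem_timeIco
    (hu : ∀ b ∈ timeIoo T, ∀ i, LipschitzOnWith (K b) (u i) (Icc 0 b))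
    (hbdd : ∀ b ∈ timeIoo T, BddAbove (range fun i => u i b)) {t : ℝ} (ht : t ∈ timeIco T) :
    BddAbove (range fun i => u i t) := by
  obtain ⟨b, hb, htb⟩ := exists_gt_mem_timeIoo ht
  exact bddAbove_range_of_lipschitzOnWith (hu b hb) ⟨ht.1, htb.le⟩ (right_mem_Icc.mpr hb.1.le)
    (hbdd b hb)

theorem locallyLipschitzOn_timeIco_iSup [Nonempty ι]
    (hu : ∀ b ∈ timeIoo T, ∀ i, LipschitzOnWith (K b) (u i) (Icc 0 b))
    (hbdd : ∀ b ∈ timeIoo T, BddAbove (range fun i => u i b)) :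
    LocallyLipschitzOn (timeIco T) fun t => ⨆ i, u i t :=
  locallyLipschitzOn_timeIco fun b hb => ⟨K b, lipschitzOnWith_iSup (hu b hb) fun _ ht =>
    bddAbove_range_of_mem_timeIco hu hbdd (Icc_subset_timeIco (timeIoo_subset_timeIco hb) ht)⟩

theorem equidifferentiableAt_of_mem_timeIoo {C : ℝ → ℝ} {α : ℝ} (hα : 0 < α)
    (hd : ∀ t ∈ timeIoo T, ∀ i, DifferentiableAt ℝ (u i) t)
    (hH : ∀ b ∈ timeIoo T, ∀ i, ∀ s ∈ Ioc 0 b, ∀ s' ∈ Ioc 0 b,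
      |deriv (u i) s - deriv (u i) s'| ≤ C b * |s - s'| ^ α) {t : ℝ} (ht : t ∈ timeIoo T) :
    EquidifferentiableAt u t := by
  obtain ⟨b, hb, htb⟩ := exists_gt_mem_timeIoo (timeIoo_subset_timeIco ht)
  refine .of_equicontinuousAt_deriv (eventually_of_mem (isOpen_timeIoo.mem_nhds ht) hd)
    (equicontinuousAt_of_dist_le_rpow (C := C b) hα ?_)
  filter_upwards [Ioo_mem_nhds ht.1 htb] with s hs i
  exact hH b hb i t ⟨ht.1, htb.le⟩ s (Ioo_subset_Ioc_self hs)

end TimeInterval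

section Matrices

open Matrix

variable {ι : Type*} [Fintype ι]

-- For singular `A` both sides are `0`, the junk value of `A⁻¹`.
theorem matrix_inv_mul_mul_inv {R : Type*} [CommRing R] [DecidableEq ι] (A : Matrix ι ι R) :
    A⁻¹ * A * A⁻¹ = A⁻¹ := by
  by_cases h : IsUnit A.det
  · rw [nonsing_inv_mul _ h, Matrix.one_mul]
  · rw [nonsing_inv_apply_not_isUnit _ h, Matrix.mul_zero]

theorem sum_sum_mul_mul_eq_dotProduct_mulVec {R : Type*} [CommSemiring R] (A : Matrix ι ι R)
    (v : ι → R) :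
    ∑ i, ∑ j, A i j * v i * v j = v ⬝ᵥ A *ᵥ v := by
  simp only [dotProduct, mulVec, Finset.mul_sum]
  exact Finset.sum_congr rfl fun i _ => Finset.sum_congr rfl fun j _ => by ring

open scoped MatrixOrder in
theorem exists_eq_transpose_mul_self_of_posSemidef {P : Matrix ι ι ℝ} (hP : P.PosSemidef) :
    ∃ R : Matrix ι ι ℝ, P = Rᵀ * R := by
  classical
  obtain ⟨R, hR⟩ := CStarAlgebra.nonneg_iff_eq_star_mul_self.mp hP.nonneg
  exact ⟨R, by rw [hR, star_eq_conjTranspose, conjTranspose_eq_transpose_of_trivial]⟩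

theorem trace_mul_transpose_nonneg {P A : Matrix ι ι ℝ} (hP : P.PosSemidef)
    (hA : ∀ v, 0 ≤ v ⬝ᵥ A *ᵥ v) : 0 ≤ (P * Aᵀ).trace := by
  obtain ⟨R, rfl⟩ := exists_eq_transpose_mul_self_of_posSemidef hP
  have hcycle : (Rᵀ * R * Aᵀ).trace = (R * A * Rᵀ).trace := by
    rw [← trace_mul_cycle A Rᵀ R, ← trace_transpose]
    simp [Matrix.mul_assoc]
  rw [hcycle]
  exact Finset.sum_nonneg fun m _ => by simpa [mul_mul_apply] using hA (R m)

theorem sq_trace_le_card_mul_trace_mul_transpose {R : Type*} [CommRing R] [LinearOrder R]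
    [IsStrictOrderedRing R] (A : Matrix ι ι R) :
    A.trace ^ 2 ≤ Fintype.card ι * (A * Aᵀ).trace := by
  refine sq_sum_le_card_mul_sum_sq.trans ?_
  rw [Finset.card_univ]
  refine mul_le_mul_of_nonneg_left (Finset.sum_le_sum fun i _ => ?_) (Nat.cast_nonneg _)
  simpa [mul_apply, sq] using Finset.single_le_sum (f := fun j => A i j * A i j)
    (fun j _ => mul_self_nonneg _) (Finset.mem_univ i)

theorem sq_trace_mul_le_card_mul_trace {P : Matrix ι ι ℝ} (hP : P.PosSemidef)
    (A : Matrix ι ι ℝ) :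
    (P * A).trace ^ 2 ≤ Fintype.card ι * (P * A * P * Aᵀ).trace := by
  obtain ⟨R, rfl⟩ := exists_eq_transpose_mul_self_of_posSemidef hP
  have hleft : (Rᵀ * R * A).trace = (R * A * Rᵀ).trace := by
    rw [Matrix.mul_assoc, trace_mul_comm]
  have hright : (Rᵀ * R * A * (Rᵀ * R) * Aᵀ).trace = (R * A * Rᵀ * (R * A * Rᵀ)ᵀ).trace := by
    rw [transpose_mul, transpose_mul, transpose_transpose]
    simp only [Matrix.mul_assoc]
    rw [trace_mul_comm]
    simp only [Matrix.mul_assoc]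
  rw [hleft, hright]
  exact sq_trace_le_card_mul_trace_mul_transpose _

end Matrices

theorem apply_self_nonneg_of_pos {E : Type*} [AddCommGroup E] [Module ℝ E] [TopologicalSpace E]
    {A : E →L[ℝ] E →L[ℝ] ℝ} (hA : ∀ v, v ≠ 0 → 0 < A v v) (v : E) : 0 ≤ A v v := by
  rcases eq_or_ne v 0 with rfl | hv
  · rw [map_zero]
  · exact (hA v hv).le

namespace RiemCoord

variable {n : ℕ} {M : Type*} [TopologicalSpace M]
  [ChartedSpace (EuclideanSpace ℝ (Fin n)) M]

section Metric

open Matrix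

theorem dotProduct_comp_mulVec (x : M)
    (A : TangentSpace (𝓡 n) x →L[ℝ] TangentSpace (𝓡 n) x →L[ℝ] ℝ) (v : Fin n → ℝ) :
    v ⬝ᵥ comp x A *ᵥ v = A (∑ i, v i • frame x i) (∑ i, v i • frame x i) := by
  rw [← sum_sum_mul_mul_eq_dotProduct_mulVec, map_sum (A (∑ i, v i • frame x i)), Finset.sum_comm]
  refine Finset.sum_congr rfl fun j _ => ?_
  rw [map_smul, map_sum, _root_.sum_apply, smul_eq_mul, Finset.mul_sum]
  refine Finset.sum_congr rfl fun i _ => ?_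
  rw [map_smul, _root_.smul_apply, smul_eq_mul, comp, Matrix.of_apply]
  ring

theorem comp_posSemidef {x : M}
    {A : TangentSpace (𝓡 n) x →L[ℝ] TangentSpace (𝓡 n) x →L[ℝ] ℝ}
    (hsymm : ∀ v w, A v w = A w v) (hnonneg : ∀ v, 0 ≤ A v v) : (comp x A).PosSemidef :=
  .of_dotProduct_mulVec_nonneg (IsHermitian.ext fun _ _ => hsymm _ _) fun v => by
    simpa only [star_trivial, dotProduct_comp_mulVec] using hnonneg _

variable [IsManifold (𝓡 n) ∞ M] (g : SmoothMetric n M) (x : M)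

theorem metricMat_posSemidef : (metricMat g x).PosSemidef :=
  comp_posSemidef (g.symm x) (apply_self_nonneg_of_pos (g.pos x))

theorem invMetric_posSemidef : (invMetric g x).PosSemidef :=
  (metricMat_posSemidef g x).inv

theorem contract_eq_trace (A B : Matrix (Fin n) (Fin n) ℝ) :
    contract g x A B = (invMetric g x * A * invMetric g x * Bᵀ).trace := by
  have hsymm : ∀ j l, invMetric g x l j = invMetric g x j l := fun j l =>
    (invMetric_posSemidef g x).isHermitian.apply j l
  rw [← sum_hadamard_eq]
  refine Finset.sum_congr rfl fun i _ => Finset.sum_congr rfl fun j _ => ?_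
  simp only [hadamard_apply, mul_apply, Finset.sum_mul, hsymm j]
  rw [Finset.sum_comm]
  exact Finset.sum_congr rfl fun l _ => Finset.sum_congr rfl fun k _ => by ring

theorem contract_metricMat (A : Matrix (Fin n) (Fin n) ℝ) :
    contract g x A (metricMat g x) = (invMetric g x * A).trace := by
  have hG : (metricMat g x)ᵀ = metricMat g x := by
    simpa using (metricMat_posSemidef g x).isHermitian.eq
  rw [contract_eq_trace, hG, Matrix.mul_assoc, trace_mul_comm, ← Matrix.mul_assoc, invMetric,
    matrix_inv_mul_mul_inv]

theorem contract_metricMat_le (A : Matrix (Fin n) (Fin n) ℝ) :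
    contract g x A (metricMat g x) ≤ √n * tensorNorm g x A := by
  have h := sq_trace_mul_le_card_mul_trace (invMetric_posSemidef g x) A
  rw [Fintype.card_fin, ← contract_eq_trace] at h
  rw [contract_metricMat, tensorNorm, ← Real.sqrt_mul (Nat.cast_nonneg n)]
  exact Real.le_sqrt_of_sq_le h

variable {g x}

theorem contract_le_of_dotProduct_mulVec_le {A B : Matrix (Fin n) (Fin n) ℝ} {ε : ℝ}
    (hε : 0 ≤ ε) (hA : A.PosSemidef)
    (hB : ∀ v : Fin n → ℝ, v ⬝ᵥ B *ᵥ v ≤ ε * (v ⬝ᵥ metricMat g x *ᵥ v)) :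
    contract g x A B ≤ ε * (√n * tensorNorm g x A) := by
  have hP : (invMetric g x)ᴴ = invMetric g x := (invMetric_posSemidef g x).isHermitian.eq
  have hPAP : (invMetric g x * A * invMetric g x).PosSemidef := by
    simpa only [hP] using hA.mul_mul_conjTranspose_same (invMetric g x)
  have hdiff : 0 ≤ ε * contract g x A (metricMat g x) - contract g x A B := by
    have h := trace_mul_transpose_nonneg (A := ε • metricMat g x - B) hPAP fun v => by
      simpa [sub_mulVec, smul_mulVec] using hB v
    simpa [contract_eq_trace, Matrix.mul_sub] using h
  exact (sub_nonneg.mp hdiff).trans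
    (mul_le_mul_of_nonneg_left (contract_metricMat_le g x A) hε)

theorem inner_le_vecNorm_mul_vecNorm (v w : TangentSpace (𝓡 n) x) :
    g.inner x v w ≤ vecNorm g x v * vecNorm g x w := by
  have hnonneg : ∀ z, 0 ≤ g.inner x z z := apply_self_nonneg_of_pos (g.pos x)
  have hsq : g.inner x v w ^ 2 ≤ g.inner x v v * g.inner x w w :=
    LinearMap.BilinForm.apply_sq_le_of_symm (g.inner x).toLinearMap₁₂ hnonneg ⟨g.symm x⟩ v w
  rw [vecNorm, vecNorm, ← Real.sqrt_mul (hnonneg v)]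
  exact Real.le_sqrt_of_sq_le hsq

end Metric

section SpaceTime

variable {k : WithTop ℕ∞} {s : Set ℝ} {u : M → ℝ → ℝ}

theorem contMDiff_space_slice
    (hu : ContMDiffOn ((𝓡 n).prod 𝓘(ℝ, ℝ)) 𝓘(ℝ, ℝ) k (fun p : M × ℝ => u p.1 p.2) (univ ×ˢ s))
    {t : ℝ} (ht : t ∈ s) : ContMDiff (𝓡 n) 𝓘(ℝ, ℝ) k fun x => u x t :=
  contMDiffOn_univ.mp <| hu.comp (t := univ ×ˢ s) (f := fun x : M => (x, t))
    (contMDiff_id.prodMk contMDiff_const).contMDiffOn fun _ _ => ⟨mem_univ _, ht⟩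

theorem contDiffOn_time_slice
    (hu : ContMDiffOn ((𝓡 n).prod 𝓘(ℝ, ℝ)) 𝓘(ℝ, ℝ) k (fun p : M × ℝ => u p.1 p.2) (univ ×ˢ s))
    (x : M) : ContDiffOn ℝ k (u x) s :=
  contMDiffOn_iff_contDiffOn.mp <| hu.comp (t := univ ×ˢ s) (f := fun t : ℝ => (x, t))
    (contMDiff_const.prodMk contMDiff_id).contMDiffOn fun _ ht => ⟨mem_univ _, ht⟩

end SpaceTime

section OmoriYau

variable [IsManifold (𝓡 n) ∞ M] {g : SmoothMetric n M}
  {A : (x : M) → TangentSpace (𝓡 n) x →L[ℝ] TangentSpace (𝓡 n) x →L[ℝ] ℝ}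
  {V : (x : M) → TangentSpace (𝓡 n) x} {C₀ C₁ : ℝ}

theorem OmoriYau.nonempty (hOY : OmoriYau g) : Nonempty M := by
  by_contra hM
  rw [not_nonempty_iff] at hM
  obtain ⟨x, -⟩ := hOY (fun _ => 0) contMDiff_const (by simp)
  exact hM.false (x 0)

theorem OmoriYau.exists_tendsto_contract_add_inner_le (hOY : OmoriYau g) {f : M → ℝ}
    (hf : ContMDiff (𝓡 n) 𝓘(ℝ, ℝ) 2 f) (hbdd : BddAbove (range f))
    (hAsymm : ∀ x v w, A x v w = A x w v) (hAnonneg : ∀ x v, 0 ≤ A x v v)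
    (hA : ∀ x, tensorNorm g x (comp x (A x)) ≤ C₀) (hV : ∀ x, vecNorm g x (V x) ≤ C₁) :
    ∃ x : ℕ → M, Tendsto (fun k => f (x k)) atTop (𝓝 (⨆ y, f y)) ∧
      ∀ ε > 0, ∀ᶠ k in atTop, contract g (x k) (comp (x k) (A (x k))) (hess g f (x k))
        + g.inner (x k) (V (x k)) (grad g f (x k)) ≤ ε := by
  obtain ⟨x, hx⟩ := hOY f hf hbdd
  have hlim : Tendsto (fun k : ℕ => 1 / ((k : ℝ) + 1)) atTop (𝓝 0) :=
    tendsto_one_div_add_atTop_nhds_zero_nat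
  refine ⟨x, ?_, fun ε hε => ?_⟩
  · exact tendsto_of_tendsto_of_tendsto_of_le_of_le (by simpa using hlim.const_sub (⨆ y, f y))
      tendsto_const_nhds (fun k => (hx k).1.le) fun k => le_ciSup hbdd (x k)
  have hlim' : Tendsto (fun k : ℕ => 1 / ((k : ℝ) + 1) * (√n * C₀ + C₁)) atTop (𝓝 0) := by
    simpa using hlim.mul_const (√n * C₀ + C₁)
  filter_upwards [hlim'.eventually_lt_const hε] with k hk
  obtain ⟨-, hgrad, hhess⟩ := hx k
  have hk0 : (0 : ℝ) ≤ 1 / ((k : ℝ) + 1) := by positivity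
  have hcontract : contract g (x k) (comp (x k) (A (x k))) (hess g f (x k))
      ≤ 1 / ((k : ℝ) + 1) * (√n * C₀) := by
    refine (contract_le_of_dotProduct_mulVec_le hk0
      (comp_posSemidef (hAsymm _) (hAnonneg _)) fun v => ?_).trans (by gcongr; exact hA _)
    simp only [← sum_sum_mul_mul_eq_dotProduct_mulVec]
    rcases eq_or_ne v 0 with rfl | hv
    · simp
    · exact (hhess v hv).le
  have hinner : g.inner (x k) (V (x k)) (grad g f (x k)) ≤ C₁ * (1 / ((k : ℝ) + 1)) :=
    (inner_le_vecNorm_mul_vecNorm _ _).trans <|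
      mul_le_mul (hV _) hgrad.le (Real.sqrt_nonneg _) ((Real.sqrt_nonneg _).trans (hV (x k)))
  linarith

theorem OmoriYau.eventually_slope_supSpace_lt (hOY : OmoriYau g) {u : M → ℝ → ℝ} {t : ℝ}
    (hu : ContMDiff (𝓡 n) 𝓘(ℝ, ℝ) 2 fun x => u x t) (hequi : EquidifferentiableAt u t)
    (hbdd : ∀ᶠ s in 𝓝 t, BddAbove (range fun x => u x s))
    (hAsymm : ∀ x v w, A x v w = A x w v) (hAnonneg : ∀ x v, 0 ≤ A x v v)
    (hA : ∀ x, tensorNorm g x (comp x (A x)) ≤ C₀) (hV : ∀ x, vecNorm g x (V x) ≤ C₁)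
    {F : ℝ → ℝ} (hF : ContinuousAt F (supSpace u t))
    (hle : ∀ x, deriv (u x) t - contract g x (comp x (A x)) (hess g (fun y => u y t) x)
      ≤ g.inner x (V x) (grad g (fun y => u y t) x) + F (u x t))
    {r : ℝ} (hr : F (supSpace u t) < r) : ∀ᶠ s in 𝓝[<] t, slope (supSpace u) t s < r := by
  obtain ⟨x, hx, hsmall⟩ := hOY.exists_tendsto_contract_add_inner_le hu hbdd.self_of_nhds
    hAsymm hAnonneg hA hV
  obtain ⟨q, hFq, hqr⟩ := exists_between hr
  obtain ⟨p, hFp, hpq⟩ := exists_between hFq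
  refine hequi.eventually_slope_iSup_lt hbdd hx (D := q) ?_ hqr
  filter_upwards [hsmall (q - p) (sub_pos.mpr hpq),
    (hF.tendsto.comp hx).eventually_lt_const hFp] with k hk hFk
  have hFk : F (u (x k) t) < p := hFk
  linarith [hle (x k)]

end OmoriYau

end RiemCoord

theorem theorem2_general {n : ℕ} {M : Type*} [TopologicalSpace M]
    [ChartedSpace (EuclideanSpace ℝ (Fin n)) M] [IsManifold (𝓡 n) ∞ M]
    {T : EReal} {g : ℝ → SmoothMetric n M}
    (hOY : ∀ t ∈ timeIoo T, RiemCoord.OmoriYau (g t))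
    {u : M → ℝ → ℝ}
    (hspace : ∀ t ∈ timeIoo T, ContMDiff (𝓡 n) 𝓘(ℝ, ℝ) 2 fun x => u x t)
    (htime : ∀ x, ContinuousOn (u x) (timeIco T))
    (hequi : ∀ t ∈ timeIoo T, EquidifferentiableAt u t)
    {C : ℝ → ℝ} (hubd : ∀ t ∈ timeIoo T, ∀ x, u x t ≤ C t)
    (hutbd : ∀ t ∈ timeIoo T, ∀ x, ∀ s ∈ Ioc 0 t, |deriv (u x) s| ≤ C t)
    {H : (x : M) → ℝ → (TangentSpace (𝓡 n) x →L[ℝ] TangentSpace (𝓡 n) x →L[ℝ] ℝ)}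
    (hHsymm : ∀ t ∈ timeIoo T, ∀ x, ∀ v w : TangentSpace (𝓡 n) x, H x t v w = H x t w v)
    (hHnonneg : ∀ t ∈ timeIoo T, ∀ x, ∀ v : TangentSpace (𝓡 n) x, 0 ≤ H x t v v)
    {C₀ : ℝ → ℝ}
    (hHbd : ∀ t ∈ timeIoo T, ∀ x,
      RiemCoord.tensorNorm (g t) x (RiemCoord.comp x (H x t)) ≤ C₀ t)
    {V : (x : M) → ℝ → TangentSpace (𝓡 n) x} {C₁ : ℝ → ℝ}
    (hVbd : ∀ t ∈ timeIoo T, ∀ x, RiemCoord.vecNorm (g t) x (V x t) ≤ C₁ t)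
    {F : ℝ → ℝ} (hF : LocallyLipschitz F)
    (hle : ∀ t ∈ timeIoo T, ∀ x,
      deriv (u x) t
          - RiemCoord.contract (g t) x (RiemCoord.comp x (H x t))
              (RiemCoord.hess (g t) (fun y => u y t) x)
        ≤ (g t).inner x (V x t) (RiemCoord.grad (g t) (fun y => u y t) x) + F (u x t)) :
    (∀ t ∈ timeIco T, IsLUB (range fun x => u x t) (RiemCoord.supSpace u t)) ∧
    LocallyLipschitzOn (timeIco T) (RiemCoord.supSpace u) ∧
    (∀ᵐ t ∂(volume.restrict (timeIco T)), DifferentiableAt ℝ (RiemCoord.supSpace u) t) ∧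
    (∀ t ∈ timeIoo T, DifferentiableAt ℝ (RiemCoord.supSpace u) t →
      ∀ x : ℕ → M, Tendsto (fun k => u (x k) t) atTop (𝓝 (RiemCoord.supSpace u t)) →
        Tendsto (fun k => deriv (u (x k)) t) atTop (𝓝 (deriv (RiemCoord.supSpace u) t))) ∧
    (∀ (T' : EReal) (φ : ℝ → ℝ),
      (∀ t ∈ timeIco T', HasDerivWithinAt φ (F (φ t)) (timeIco T') t) →
      φ 0 = RiemCoord.supSpace u 0 →
      ∀ x, ∀ t ∈ timeIco (min T T'), u x t ≤ φ t) := by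
  have hlip : ∀ b ∈ timeIoo T, ∀ x, LipschitzOnWith (C b).toNNReal (u x) (Icc 0 b) :=
    fun b hb x => lipschitzOnWith_Icc_of_mem_timeIoo (htime x)
      (fun t ht => (hequi t ht).differentiableAt x) hb (hutbd b hb x)
  have hbddIoo : ∀ b ∈ timeIoo T, BddAbove (range fun x => u x b) := fun b hb =>
    ⟨C b, forall_mem_range.mpr (hubd b hb)⟩
  have hbdd : ∀ t ∈ timeIco T, BddAbove (range fun x => u x t) := fun _ =>
    bddAbove_range_of_mem_timeIco hlip hbddIoo
  have hbdd_nhds : ∀ t ∈ timeIoo T, ∀ᶠ s in 𝓝 t, BddAbove (range fun x => u x s) := fun _ ht =>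
    eventually_of_mem (timeIco_mem_nhds ht) hbdd
  have hne : ∀ t ∈ timeIco T, Nonempty M := fun _ ht =>
    let ⟨b, hb, _⟩ := exists_gt_mem_timeIoo ht
    (hOY b hb).nonempty
  have hsup : LocallyLipschitzOn (timeIco T) (RiemCoord.supSpace u) := fun t ht =>
    have := hne t ht
    locallyLipschitzOn_timeIco_iSup hlip hbddIoo ht
  have hslope : ∀ t ∈ timeIoo T, ∀ r, F (RiemCoord.supSpace u t) < r →
      ∀ᶠ s in 𝓝[<] t, slope (RiemCoord.supSpace u) t s < r := fun t ht _ hr =>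
    (hOY t ht).eventually_slope_supSpace_lt (hspace t ht) (hequi t ht) (hbdd_nhds t ht)
      (hHsymm t ht) (hHnonneg t ht) (hHbd t ht) (hVbd t ht) hF.continuous.continuousAt (hle t ht) hr
  refine ⟨fun t ht => ?_, hsup, ae_differentiableAt_of_locallyLipschitzOn ordConnected_timeIco hsup,
    fun t ht hd x hx => (hequi t ht).tendsto_deriv_of_hasDerivAt_iSup (hbdd_nhds t ht)
      hd.hasDerivAt hx, fun T' φ hφ hφ0 x t ht => ?_⟩
  · have := hne t ht
    exact isLUB_ciSup (hbdd t ht)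
  · have hcompare : RiemCoord.supSpace u t ≤ φ t :=
      le_of_liminf_slope_left_le_timeIco hF hsup.continuousOn
        (fun s hs r hr => (hslope s hs r hr).frequently) hφ hφ0.ge ht
    exact (le_ciSup (hbdd t (timeIco_min T T' ▸ ht).1) x).trans hcompare

theorem theorem2 {n : ℕ} {M : Type*} [TopologicalSpace M]
    [T2Space M] [SecondCountableTopology M]
    [ChartedSpace (EuclideanSpace ℝ (Fin n)) M] [IsManifold (𝓡 n) ∞ M]
    (T : EReal)
    -- the metrics
    (g : ℝ → SmoothMetric n M)
    (hg : RiemCoord.SmoothFamily T g)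
    (hOY : ∀ t ∈ timeIco T, RiemCoord.OmoriYau (g t))
    -- the solution and its bounds
    (u : M → ℝ → ℝ)
    (hu : ContMDiffOn ((𝓡 n).prod 𝓘(ℝ, ℝ)) 𝓘(ℝ, ℝ) ∞ (fun p : M × ℝ => u p.1 p.2)
      (univ ×ˢ timeIco T))
    (C : ℝ → ℝ) (α : ℝ) (hα0 : 0 < α) (hα1 : α ≤ 1)
    (hubd : ∀ t ∈ timeIoo T, ∀ x, |u x t| ≤ C t)
    (hgrad : ∀ t ∈ timeIoo T, ∀ x,
      RiemCoord.vecNorm (g t) x (RiemCoord.grad (g t) (fun y => u y t) x) ≤ C t)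
    (hutbd : ∀ t ∈ timeIoo T, ∀ x, ∀ s ∈ Ioc 0 t, |deriv (u x) s| ≤ C t)
    (hutHolder : ∀ t ∈ timeIoo T, ∀ x, ∀ s ∈ Ioc 0 t, ∀ s' ∈ Ioc 0 t,
      |deriv (u x) s - deriv (u x) s'| ≤ C t * |s - s'| ^ α)
    -- the coefficients
    (H : (x : M) → ℝ → (TangentSpace (𝓡 n) x →L[ℝ] TangentSpace (𝓡 n) x →L[ℝ] ℝ))
    (hHsymm : ∀ t ∈ timeIoo T, ∀ x, ∀ v w : TangentSpace (𝓡 n) x, H x t v w = H x t w v)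
    (hHpos : ∀ t ∈ timeIoo T, ∀ x, ∀ v : TangentSpace (𝓡 n) x, v ≠ 0 → 0 < H x t v v)
    (C₀ : ℝ)
    (hHbd : ∀ t ∈ timeIoo T, ∀ x,
      RiemCoord.tensorNorm (g t) x (RiemCoord.comp x (H x t)) ≤ C₀)
    (X : (x : M) → ℝ → TangentSpace (𝓡 n) x → ℝ → TangentSpace (𝓡 n) x)
    (C₁ : ℝ → ℝ)
    (hXbd : ∀ t ∈ timeIoo T, ∀ x,
      RiemCoord.vecNorm (g t) x
        (X x (u x t) (RiemCoord.grad (g t) (fun y => u y t) x) t) ≤ C₁ t)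
    (F : ℝ → ℝ) (hF : LocallyLipschitz F)
    -- the evolution equation
    (heq : ∀ t ∈ timeIoo T, ∀ x,
      deriv (u x) t
          - RiemCoord.contract (g t) x (RiemCoord.comp x (H x t))
              (RiemCoord.hess (g t) (fun y => u y t) x)
        = (g t).inner x (X x (u x t) (RiemCoord.grad (g t) (fun y => u y t) x) t)
              (RiemCoord.grad (g t) (fun y => u y t) x)
          + F (u x t)) :
    -- the supremum is finite, locally Lipschitz, and differentiable almost everywhere
    (∀ t ∈ timeIco T, IsLUB (range fun x => u x t) (RiemCoord.supSpace u t)) ∧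
    LocallyLipschitzOn (timeIco T) (RiemCoord.supSpace u) ∧
    (∀ᵐ t ∂(volume.restrict (timeIco T)), DifferentiableAt ℝ (RiemCoord.supSpace u) t) ∧
    -- its derivative is the limit of `u_t` along any maximizing sequence
    (∀ t ∈ timeIoo T, DifferentiableAt ℝ (RiemCoord.supSpace u) t →
      ∀ x : ℕ → M, Tendsto (fun k => u (x k) t) atTop (𝓝 (RiemCoord.supSpace u t)) →
        Tendsto (fun k => deriv (u (x k)) t) atTop (𝓝 (deriv (RiemCoord.supSpace u) t))) ∧
    -- comparison with the ODE
    (∀ (T' : EReal) (φ : ℝ → ℝ),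
      (∀ t ∈ timeIco T', HasDerivWithinAt φ (F (φ t)) (timeIco T') t) →
      φ 0 = RiemCoord.supSpace u 0 →
      ∀ x, ∀ t ∈ timeIco (min T T'), u x t ≤ φ t) := by
  have htime := RiemCoord.contDiffOn_time_slice hu
  have hspace : ∀ t ∈ timeIoo T, ContMDiff (𝓡 n) 𝓘(ℝ, ℝ) ∞ fun x => u x t := fun t ht =>
    RiemCoord.contMDiff_space_slice hu (timeIoo_subset_timeIco ht)
  have hequi : ∀ t ∈ timeIoo T, EquidifferentiableAt u t := fun _ =>
    equidifferentiableAt_of_mem_timeIoo hα0 (fun t ht x =>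
      ((htime x).contDiffAt (timeIco_mem_nhds ht)).differentiableAt (by simp)) hutHolder
  exact theorem2_general (fun t ht => hOY t (timeIoo_subset_timeIco ht))
    (fun t ht => (hspace t ht).of_le ENat.LEInfty.out) (fun x => (htime x).continuousOn) hequi
    (fun t ht x => le_of_abs_le (hubd t ht x)) hutbd hHsymm
    (fun t ht x => apply_self_nonneg_of_pos (hHpos t ht x)) hHbd hXbd hF
    fun t ht x => (heq t ht x).le
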